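/- For a positive integer $n$ let $H_n=\{(x,y)\in\mathbb{R}^2 : x\ge 0,\ y\ge 0,\ xy\ge n\}$, and let $V_n$ be the set of vertices (extreme points) of $\operatorname{conv}(H_n\cap\mathbb{Z}^2)$. Consider the integer RAM: memory cells hold arbitrary integers, and a program is a finite list of instructions; the instructions are assignments of constants, copies (with direct or indirect addressing), additions, subtractions, multiplications, integer divisions $\lfloor a/b\rfloor$ with $b\neq 0$, integer square roots $\lfloor\sqrt a\rfloor$ with $a\ge 0$, unconditional jumps, jumps conditional on a comparison of two cells ($a<b$ or $a=b$), and halting. Each executed instruction costs one unit of time. There are a single program and a function $T:\mathbb{N}\to\mathbb{N}$ with $T(n)=O(\log n)$ as $n\to\infty$ such that, for every integer $n\ge 1$ and every ${\bf p}=({\bf p}_x,{\bf p}_y)\in V_n$, the program with input $(n,{\bf p}_x,{\bf p}_y)$ halts after at most $T(n)$ executed instructions, and it outputs the next vertex, that is, the ${\bf p}'=({\bf p}'_x,{\bf p}'_y)\in V_n$ with $${\bf p}'_x=\min\{x>{\bf p}_x : (x,y)\in V_n\text{ for some }y\},$$ if this set is non-empty, and otherwise it reports that there is no next vertex. -/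

import Mathlib

/-! ## Lattice points above the hyperbola -/

/-- The closed region `{(x, y) : x ≥ 0, y ≥ 0, x y ≥ n}` above the positive branch of `x y = n`. -/
def hyperbolaRegion (n : ℕ) : Set (ℝ × ℝ) :=
  {z | 0 ≤ z.1 ∧ 0 ≤ z.2 ∧ (n : ℝ) ≤ z.1 * z.2}

/-- An integer point, seen as a point of the real plane. -/
def toPlane (z : ℤ × ℤ) : ℝ × ℝ := ((z.1 : ℝ), (z.2 : ℝ))

/-- The lattice `ℤ²` in the real plane. -/
def integerLattice : Set (ℝ × ℝ) := Set.range toPlane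

/-- The vertices (extreme points) of the convex hull of the lattice points above the hyperbola. -/
def hullVertices (n : ℕ) : Set (ℝ × ℝ) :=
  Set.extremePoints ℝ (convexHull ℝ (hyperbolaRegion n ∩ integerLattice))

/-- The `x`-coordinates of the vertices that lie strictly to the right of `p`. -/
def laterAbscissas (n : ℕ) (p : ℝ × ℝ) : Set ℝ :=
  {x | p.1 < x ∧ ∃ y, (x, y) ∈ hullVertices n}

/-- `q` is the next vertex after `p`: the vertex with the least `x`-coordinate larger
than that of `p`. -/
def IsNextVertex (n : ℕ) (p q : ℝ × ℝ) : Prop :=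
  q ∈ hullVertices n ∧ IsLeast (laterAbscissas n p) q.1

/-! ## The arithmetic random access machine

Memory cells are indexed by `ℕ` and hold arbitrary integers. A program is a finite list of
instructions, and every executed instruction costs one time unit. -/

namespace RAM

/-- Instructions. The arguments `d a b` are addresses of memory cells, `l` is a
position in the program. -/
inductive Instr where
  /-- `M[d] := k` -/
  | const (d : ℕ) (k : ℤ)
  /-- `M[d] := M[a]` -/
  | copy (d a : ℕ)
  /-- `M[d] := M[M[a]]`; fails if `M[a] < 0` -/
  | load (d a : ℕ)
  /-- `M[M[d]] := M[a]`; fails if `M[d] < 0` -/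
  | store (d a : ℕ)
  /-- `M[d] := M[a] + M[b]` -/
  | add (d a b : ℕ)
  /-- `M[d] := M[a] - M[b]` -/
  | sub (d a b : ℕ)
  /-- `M[d] := M[a] * M[b]` -/
  | mul (d a b : ℕ)
  /-- `M[d] := ⌊M[a] / M[b]⌋`; fails if `M[b] = 0` -/
  | div (d a b : ℕ)
  /-- `M[d] := ⌊√M[a]⌋`; fails if `M[a] < 0` -/
  | sqrt (d a : ℕ)
  /-- continue at position `l` -/
  | jump (l : ℕ)
  /-- continue at position `l` if `M[a] < M[b]` -/
  | jumpLt (a b l : ℕ)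
  /-- continue at position `l` if `M[a] = M[b]` -/
  | jumpEq (a b l : ℕ)
  /-- stop -/
  | halt

/-- A program is a finite list of instructions. -/
abbrev Program := List Instr

/-- A configuration: the position in the program and the content of the memory. -/
structure Config where
  pc : ℕ
  mem : ℕ → ℤ

/-- Write `v` to cell `d` and go on to the next instruction. -/
def Config.write (c : Config) (d : ℕ) (v : ℤ) : Config :=
  ⟨c.pc + 1, Function.update c.mem d v⟩

/-- Go to position `l` if `b` holds and to the next instruction otherwise. -/
def Config.branch (c : Config) (b : Prop) [Decidable b] (l : ℕ) : Config :=
  ⟨if b then l else c.pc + 1, c.mem⟩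

/-- The effect of one instruction; `none` if the machine halts or the instruction fails. -/
def exec (c : Config) : Instr → Option Config
  | .const d k => some (c.write d k)
  | .copy d a => some (c.write d (c.mem a))
  | .load d a => if c.mem a < 0 then none else some (c.write d (c.mem (c.mem a).toNat))
  | .store d a => if c.mem d < 0 then none else some (c.write (c.mem d).toNat (c.mem a))
  | .add d a b => some (c.write d (c.mem a + c.mem b))
  | .sub d a b => some (c.write d (c.mem a - c.mem b))
  | .mul d a b => some (c.write d (c.mem a * c.mem b))
  | .div d a b => if c.mem b = 0 then none else some (c.write d (Int.fdiv (c.mem a) (c.mem b)))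
  | .sqrt d a => if c.mem a < 0 then none else some (c.write d (Int.sqrt (c.mem a)))
  | .jump l => some (c.branch True l)
  | .jumpLt a b l => some (c.branch (c.mem a < c.mem b) l)
  | .jumpEq a b l => some (c.branch (c.mem a = c.mem b) l)
  | .halt => none

/-- One step of the machine; `none` if there is no instruction at the current position. -/
def step (P : Program) (c : Config) : Option Config :=
  (P[c.pc]?).bind (exec c)

/-- The configuration after exactly `t` steps, if all of them can be carried out. -/
def run (P : Program) : ℕ → Config → Option Config
  | 0, c => some c
  | t + 1, c => (step P c).bind (run P t)

/-- The initial configuration: the input is in cells `0, 1, 2, …`, all other cells are `0`. -/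
def initial (input : List ℤ) : Config := ⟨0, fun i => input.getD i 0⟩

/-- On `input`, the program `P` executes exactly `t` instructions without failure, then reaches a
`halt` instruction, and at that time the list `output` is in cells `0, 1, 2, …`. -/
def HaltsWith (P : Program) (input : List ℤ) (t : ℕ) (output : List ℤ) : Prop :=
  ∃ c, run P t (initial input) = some c ∧ P[c.pc]? = some .halt ∧
    ∀ i (hi : i < output.length), c.mem i = output[i]

end RAM

/-! ## Integer roots of the quadratic along a line -/

/-! Write a step from the vertex p = (a, b) to (a + u, b - v) as the direction (u, v). Take a
steepest primitive direction with u > 0 that is feasible, i.e. ends above the hyperbola. The line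
through p in this direction supports the hull (`support_line`), and the farthest lattice point on it
above the hyperbola is the next vertex (`isNextVertex_of_steepest`). If b = 1, no vertex follows
(`laterAbscissas_eq_empty`).

The steepest direction is found by an accelerated Stern-Brocot search. `SlopeBracket` keeps a
unimodular basis L, R with L feasible and every feasible direction less steep than R. A round moves
R by multiples of L as long as it stays infeasible, then L by multiples of R as long as it stays
feasible. Convexity makes this work: a feasible direction steeper than L forces some R + c L to be
feasible (`SlopeBracket.exists_feasible`), so the search may stop when no R + i L with i > 0 is.

The multiples come from roots of quadratics, hence from a square root and a division
(`largest_parameter`, `smallest_parameter`), so a round has constant cost. Each round at least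
doubles the vertical part of L, which stays below b ≤ n; this leaves O(log n) rounds
(`halts_search`). -/

theorem mul_self_le_iff_sqrt {D : ℤ} (hD : 0 ≤ D) (z : ℤ) :
    z * z ≤ D ↔ -Int.sqrt D ≤ z ∧ z ≤ Int.sqrt D := by
  have key : z * z ≤ D ↔ z.natAbs ≤ Nat.sqrt D.toNat := by
    rw [Nat.le_sqrt, ← Int.natAbs_mul_self]
    omega
  rw [key, Int.sqrt]
  omega

/-- The point `(x, y) + k (u, -v)` satisfies `n ≤ X Y`. -/
theorem le_mul_line_iff {n x y u v A B D k : ℤ} (huv : 0 < u * v) (hA : A = u * v + u * v)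
    (hB : B = y * u - x * v)
    (hD : D = B * B - (A * (n - x * y) + A * (n - x * y))) :
    n ≤ (x + k * u) * (y - k * v) ↔ (A * k - B) * (A * k - B) ≤ D := by
  -- Completing the square: A is twice the leading coefficient and D is the discriminant.
  have e : (A * k - B) * (A * k - B) - D = 4 * (u * v) * (n - (x + k * u) * (y - k * v)) := by
    subst hA hB hD; ring
  constructor
  · intro h
    nlinarith [mul_nonneg huv.le (sub_nonneg.2 h)]
  · intro h
    by_contra hc
    nlinarith [mul_pos huv (sub_pos.2 (not_le.1 hc))]

/-- The largest parameter `k` for which a point of the line is above the hyperbola. -/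
theorem largest_parameter {n x y u v A B D k₀ : ℤ} (huv : 0 < u * v) (hA : A = u * v + u * v)
    (hB : B = y * u - x * v)
    (hD : D = B * B - (A * (n - x * y) + A * (n - x * y)))
    (h₀ : n ≤ (x + k₀ * u) * (y - k₀ * v)) :
    0 ≤ D ∧ k₀ ≤ Int.fdiv (B + Int.sqrt D) A ∧
      n ≤ (x + Int.fdiv (B + Int.sqrt D) A * u) * (y - Int.fdiv (B + Int.sqrt D) A * v) ∧
      ∀ k, n ≤ (x + k * u) * (y - k * v) → k ≤ Int.fdiv (B + Int.sqrt D) A := by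
  have hA0 : 0 < A := by omega
  have iff := fun k => le_mul_line_iff (n := n) (k := k) huv hA hB hD
  have hD0 : 0 ≤ D := (mul_self_nonneg _).trans ((iff k₀).1 h₀)
  have iff' := fun k => (iff k).trans (mul_self_le_iff_sqrt hD0 _)
  have hle : ∀ k, n ≤ (x + k * u) * (y - k * v) → k ≤ Int.fdiv (B + Int.sqrt D) A := by
    intro k hk
    rw [Int.fdiv_eq_ediv_of_nonneg _ hA0.le, Int.le_ediv_iff_mul_le hA0]
    have := ((iff' k).1 hk).2
    linarith
  refine ⟨hD0, hle _ h₀, ?_, hle⟩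
  -- The rounded upper root is at least `k₀`, which already exceeds the lower root, so it lies
  -- between the two.
  have h1 := hle _ h₀
  rw [iff']
  have h2 := ((iff' k₀).1 h₀).1
  have h3 : Int.fdiv (B + Int.sqrt D) A * A ≤ B + Int.sqrt D := by
    rw [Int.fdiv_eq_ediv_of_nonneg _ hA0.le]; exact Int.ediv_mul_le _ hA0.ne'
  constructor
  · nlinarith [mul_le_mul_of_nonneg_left h1 hA0.le]
  · linarith

theorem no_parameter_of_neg {n x y u v A B D : ℤ} (huv : 0 < u * v) (hA : A = u * v + u * v)
    (hB : B = y * u - x * v)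
    (hD : D = B * B - (A * (n - x * y) + A * (n - x * y))) (h : D < 0) (k : ℤ) :
    ¬ n ≤ (x + k * u) * (y - k * v) := by
  rw [le_mul_line_iff huv hA hB hD]
  have := mul_self_nonneg (A * k - B)
  omega

/-- All parameters up to `m` are bad, and all good parameters are bounded below by the good
parameter `m + 1`. -/
theorem smallest_parameter {n x y u v A B D : ℤ} (huv : 0 < u * v) (hA : A = u * v + u * v)
    (hB : B = y * u - x * v)
    (hD : D = B * B - (A * (n - x * y) + A * (n - x * y))) (hD0 : 0 ≤ D) {m : ℤ}
    (hm : m = Int.fdiv (B - Int.sqrt D - 1) A) :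
    (∀ k ≤ m, ¬ n ≤ (x + k * u) * (y - k * v)) ∧
      ∀ k k', m < k → k ≤ k' → n ≤ (x + k' * u) * (y - k' * v) →
        n ≤ (x + k * u) * (y - k * v) := by
  have hA0 : 0 < A := by omega
  have iff' := fun k => (le_mul_line_iff (n := n) (k := k) huv hA hB hD).trans
    (mul_self_le_iff_sqrt hD0 _)
  rw [Int.fdiv_eq_ediv_of_nonneg _ hA0.le] at hm
  -- The `- 1` in the numerator makes the inequality strict: `k ≤ m` means that `k * A` is less than
  -- `B - Int.sqrt D`.
  have h : ∀ k, k ≤ m ↔ k * A ≤ B - Int.sqrt D - 1 := by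
    intro k; rw [hm, Int.le_ediv_iff_mul_le hA0]
  constructor
  · intro k hk hk'
    have h1 := (h k).1 hk
    have h2 := ((iff' k).1 hk').1
    linarith
  · intro k k' hk hkk hk'
    rw [iff']
    have h1 : ¬ k * A ≤ B - Int.sqrt D - 1 := fun h' => absurd ((h k).2 h') (by omega)
    have h2 := ((iff' k').1 hk').2
    have h3 := mul_le_mul_of_nonneg_left hkk hA0.le
    constructor
    · have : B - Int.sqrt D ≤ k * A := by omega
      linarith
    · linarith

/-! ## Lattice directions at a point above the hyperbola -/

/-- The inequality of arithmetic and geometric means for the two cross products, whose product is at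
least n². It is the convexity of the region, free of division. -/
theorem two_mul_le_cross {n x₁ y₁ x₂ y₂ : ℤ} (hn : 0 ≤ n) (hx₁ : 0 ≤ x₁) (hy₁ : 0 ≤ y₁)
    (hx₂ : 0 ≤ x₂) (hy₂ : 0 ≤ y₂) (h₁ : n ≤ x₁ * y₁) (h₂ : n ≤ x₂ * y₂) :
    2 * n ≤ x₁ * y₂ + x₂ * y₁ := by
  have h : n * n ≤ (x₁ * y₁) * (x₂ * y₂) := mul_le_mul h₁ h₂ hn (mul_nonneg hx₁ hy₁)
  refine le_of_sq_le_sq ?_ (by positivity)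
  nlinarith [sq_nonneg (x₁ * y₂ - x₂ * y₁)]

/-- Convexity of the region above the hyperbola, for three points with integer weights. -/
theorem convex_combination_mul {n x₁ y₁ x₂ y₂ x₃ y₃ w₁ w₂ w₃ : ℤ} (hn : 0 ≤ n)
    (hx₁ : 0 ≤ x₁) (hy₁ : 0 ≤ y₁) (hx₂ : 0 ≤ x₂) (hy₂ : 0 ≤ y₂) (hx₃ : 0 ≤ x₃) (hy₃ : 0 ≤ y₃)
    (h₁ : n ≤ x₁ * y₁) (h₂ : n ≤ x₂ * y₂) (h₃ : n ≤ x₃ * y₃)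
    (hw₁ : 0 ≤ w₁) (hw₂ : 0 ≤ w₂) (hw₃ : 0 ≤ w₃) :
    (w₁ + w₂ + w₃) * (w₁ + w₂ + w₃) * n ≤
      (w₁ * x₁ + w₂ * x₂ + w₃ * x₃) * (w₁ * y₁ + w₂ * y₂ + w₃ * y₃) := by
  have c₁₂ := mul_le_mul_of_nonneg_left (two_mul_le_cross hn hx₁ hy₁ hx₂ hy₂ h₁ h₂)
    (mul_nonneg hw₁ hw₂)
  have c₁₃ := mul_le_mul_of_nonneg_left (two_mul_le_cross hn hx₁ hy₁ hx₃ hy₃ h₁ h₃)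
    (mul_nonneg hw₁ hw₃)
  have c₂₃ := mul_le_mul_of_nonneg_left (two_mul_le_cross hn hx₂ hy₂ hx₃ hy₃ h₂ h₃)
    (mul_nonneg hw₂ hw₃)
  have d₁ := mul_le_mul_of_nonneg_left h₁ (mul_nonneg hw₁ hw₁)
  have d₂ := mul_le_mul_of_nonneg_left h₂ (mul_nonneg hw₂ hw₂)
  have d₃ := mul_le_mul_of_nonneg_left h₃ (mul_nonneg hw₃ hw₃)
  linear_combination c₁₂ + c₁₃ + c₂₃ + d₁ + d₂ + d₃

/-- The step from `(a, b)` by `(u, -v)` ends above the hyperbola. -/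
def Feasible (n a b u v : ℤ) : Prop := n ≤ (a + u) * (b - v)

theorem Feasible.pos {n a b u v : ℤ} (h : Feasible n a b u v) (hn : 0 < n) (ha : 0 < a)
    (hu : 0 ≤ u) : 0 < b - v :=
  pos_of_mul_pos_right (hn.trans_le h) (by omega)

/-- A basis `L = (lx, ly)`, `R = (rx, ry)` of the lattice of directions at `(a, b)`, with `L`
feasible and such that no feasible direction is at least as steep as `R`. -/
structure SlopeBracket (n a b lx ly rx ry : ℤ) : Prop where
  n_pos : 0 < n
  a_pos : 0 < a
  above : n ≤ a * b
  lx_pos : 0 < lx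
  ly_nonneg : 0 ≤ ly
  rx_nonneg : 0 ≤ rx
  ry_pos : 0 < ry
  det : lx * ry - ly * rx = 1
  left : Feasible n a b lx ly
  right : ¬ Feasible n a b rx ry
  cone : ∀ u v, 0 < u → Feasible n a b u v → 0 < u * ry - v * rx

namespace SlopeBracket

variable {n a b lx ly rx ry : ℤ}

/-- A feasible direction `i L + j R` with `i, j > 0` yields a feasible direction `c L + R` with
`c = ⌈i / j⌉`. -/
theorem exists_feasible (h : SlopeBracket n a b lx ly rx ry) {u v : ℤ} (hu : 0 < u)
    (huv : Feasible n a b u v) (hj : 0 < lx * v - ly * u) :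
    ∃ c, 0 < c ∧ (c - 1) * (lx * v - ly * u) < u * ry - v * rx ∧
      Feasible n a b (rx + c * lx) (ry + c * ly) := by
  have hi := h.cone u v hu huv
  obtain ⟨i, hidef⟩ : ∃ i, i = u * ry - v * rx := ⟨_, rfl⟩
  obtain ⟨j, hjdef⟩ : ∃ j, j = lx * v - ly * u := ⟨_, rfl⟩
  rw [← hidef] at hi ⊢
  rw [← hjdef] at hj ⊢
  have e := Int.mul_ediv_add_emod (i - 1) j
  have e0 := Int.emod_nonneg (i - 1) hj.ne'
  have e1 := Int.emod_lt_of_pos (i - 1) hj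
  have hq := Int.ediv_nonneg (by omega : 0 ≤ i - 1) hj.le
  set q := (i - 1) / j
  set r := (i - 1) % j
  have hu' : u = i * lx + j * rx := by
    rw [hidef, hjdef]; linear_combination (-u) * h.det
  have hv' : v = i * ly + j * ry := by
    rw [hidef, hjdef]; linear_combination (-v) * h.det
  refine ⟨q + 1, by omega, by linarith, ?_⟩
  -- With i - 1 = j q + r, the direction R + (q + 1) L is the mean of 0, (u, v) and L with weights
  -- r, 1 and j - 1 - r, which add up to j.
  have key := convex_combination_mul (w₁ := r) (w₂ := 1) (w₃ := j - 1 - r) h.n_pos.le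
    h.a_pos.le (pos_of_mul_pos_right (h.n_pos.trans_le h.above) h.a_pos.le).le
    (by have := h.a_pos; linarith : 0 ≤ a + u) (huv.pos h.n_pos h.a_pos hu.le).le
    (by have := h.a_pos; have := h.lx_pos; omega : 0 ≤ a + lx)
    (h.left.pos h.n_pos h.a_pos h.lx_pos.le).le h.above huv h.left e0 zero_le_one (by omega)
  have k1 : r * a + 1 * (a + u) + (j - 1 - r) * (a + lx) = j * (a + (rx + (q + 1) * lx)) := by
    rw [hu']; linear_combination lx * (-e)
  have k2 : r * b + 1 * (b - v) + (j - 1 - r) * (b - ly) = j * (b - (ry + (q + 1) * ly)) := by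
    rw [hv']; linear_combination (-ly) * (-e)
  rw [k1, k2, show r + 1 + (j - 1 - r) = j by ring] at key
  unfold Feasible
  refine le_of_mul_le_mul_left ?_ (mul_pos hj hj)
  linarith

/-- If no `R + i L` with `i > 0` is feasible, then `L` is the steepest feasible direction. -/
theorem steepest (h : SlopeBracket n a b lx ly rx ry)
    (hR : ∀ i > 0, ¬ Feasible n a b (rx + i * lx) (ry + i * ly)) {u v : ℤ} (hu : 0 < u)
    (huv : Feasible n a b u v) : lx * v ≤ ly * u := by
  by_contra hc
  obtain ⟨c, hc0, -, hc1⟩ := h.exists_feasible hu huv (by omega)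
  exact hR c hc0 hc1

/-- Moving `R` towards `L`. -/
theorem move_right (h : SlopeBracket n a b lx ly rx ry) {m : ℤ} (hm : 0 ≤ m)
    (hR : ∀ i ≤ m, ¬ Feasible n a b (rx + i * lx) (ry + i * ly)) :
    SlopeBracket n a b lx ly (rx + m * lx) (ry + m * ly) where
  n_pos := h.n_pos
  a_pos := h.a_pos
  above := h.above
  lx_pos := h.lx_pos
  ly_nonneg := h.ly_nonneg
  rx_nonneg := by have := h.rx_nonneg; have := h.lx_pos; positivity
  ry_pos := by have := h.ry_pos; have := h.ly_nonneg; positivity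
  det := by linear_combination h.det
  left := h.left
  right := hR m le_rfl
  cone := by
    intro u v hu huv
    have hi := h.cone u v hu huv
    have e : u * (ry + m * ly) - v * (rx + m * lx) =
      (u * ry - v * rx) - m * (lx * v - ly * u) := by ring
    rw [e]
    -- For a direction steeper than L, the feasible R + c L has c > m, and (c - 1) j < i gives m j <
    -- i. Otherwise j ≤ 0 and the claim is immediate.
    by_cases hj : 0 < lx * v - ly * u
    · obtain ⟨c, hc0, hc1, hc2⟩ := h.exists_feasible hu huv hj
      have hcm : m ≤ c - 1 := by
        by_contra hlt
        exact hR c (by omega) hc2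
      nlinarith [mul_le_mul_of_nonneg_right hcm hj.le]
    · nlinarith [mul_nonneg hm (by omega : 0 ≤ -(lx * v - ly * u))]

/-- Moving `L` towards `R`. -/
theorem move_left (h : SlopeBracket n a b lx ly rx ry) {k : ℤ} (hk : 0 ≤ k)
    (hL : Feasible n a b (lx + k * rx) (ly + k * ry)) :
    SlopeBracket n a b (lx + k * rx) (ly + k * ry) rx ry where
  n_pos := h.n_pos
  a_pos := h.a_pos
  above := h.above
  lx_pos := by have := h.rx_nonneg; have := h.lx_pos; positivity
  ly_nonneg := by have := h.ry_pos; have := h.ly_nonneg; positivity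
  rx_nonneg := h.rx_nonneg
  ry_pos := h.ry_pos
  det := by linear_combination h.det
  left := hL
  right := h.right
  cone := h.cone

/-- This bound limits the number of doublings in the search. -/
theorem ly_lt (h : SlopeBracket n a b lx ly rx ry) : ly < b := by
  have := h.left.pos h.n_pos h.a_pos h.lx_pos.le
  omega

end SlopeBracket

/-- The horizontal unit step stays above the hyperbola, and the vertical one leaves the region
because b is the least admissible ordinate over a. -/
theorem SlopeBracket.initial {n a b : ℤ} (hn : 0 < n) (ha : 0 < a) (hab : n ≤ a * b)
    (hb : a * (b - 1) < n) : SlopeBracket n a b 1 0 0 1 where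
  n_pos := hn
  a_pos := ha
  above := hab
  lx_pos := one_pos
  ly_nonneg := le_rfl
  rx_nonneg := le_rfl
  ry_pos := one_pos
  det := by norm_num
  left := by
    have : 0 < b := pos_of_mul_pos_right (hn.trans_le hab) ha.le
    unfold Feasible; linarith
  right := by unfold Feasible; rw [add_zero]; omega
  cone := by intro u v hu _; omega

/-! ## Vertices of the hull -/

theorem toPlane_mem_hyperbolaRegion {n : ℕ} {z : ℤ × ℤ} :
    toPlane z ∈ hyperbolaRegion n ↔ 0 ≤ z.1 ∧ 0 ≤ z.2 ∧ (n : ℤ) ≤ z.1 * z.2 := by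
  simp only [toPlane, hyperbolaRegion, Set.mem_ofPred_eq]
  exact_mod_cast Iff.rfl

theorem mem_hull {n : ℕ} {x y : ℤ} (hx : 0 ≤ x) (hy : 0 ≤ y) (h : (n : ℤ) ≤ x * y) :
    toPlane (x, y) ∈ convexHull ℝ (hyperbolaRegion n ∩ integerLattice) :=
  subset_convexHull ℝ _ ⟨toPlane_mem_hyperbolaRegion.2 ⟨hx, hy, h⟩, (x, y), rfl⟩

theorem exists_lattice_of_mem_hullVertices {n : ℕ} {z : ℝ × ℝ} (hz : z ∈ hullVertices n) :
    ∃ x y : ℤ, z = toPlane (x, y) ∧ 0 ≤ x ∧ 0 ≤ y ∧ (n : ℤ) ≤ x * y := by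
  obtain ⟨h, ⟨x, y⟩, rfl⟩ := extremePoints_convexHull_subset hz
  exact ⟨x, y, rfl, toPlane_mem_hyperbolaRegion.1 h⟩

theorem bounds_of_mem_hullVertices {n : ℕ} {x y : ℤ} (hz : toPlane (x, y) ∈ hullVertices n) :
    0 ≤ x ∧ 0 ≤ y ∧ (n : ℤ) ≤ x * y :=
  toPlane_mem_hyperbolaRegion.1 (extremePoints_convexHull_subset hz).1

theorem weighted_mem_hull {n : ℕ} {w₁ w₂ : ℝ × ℝ} {s t x y : ℝ}
    (h₁ : w₁ ∈ convexHull ℝ (hyperbolaRegion n ∩ integerLattice))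
    (h₂ : w₂ ∈ convexHull ℝ (hyperbolaRegion n ∩ integerLattice)) (hs : 0 < s) (ht : 0 < t)
    (hx : (s + t) * x = s * w₁.1 + t * w₂.1) (hy : (s + t) * y = s * w₁.2 + t * w₂.2) :
    (x, y) ∈ convexHull ℝ (hyperbolaRegion n ∩ integerLattice) := by
  have hst : 0 < s + t := by positivity
  refine (convex_convexHull ℝ _).segment_subset h₁ h₂
    ⟨s / (s + t), t / (s + t), by positivity, by positivity, by field_simp, ?_⟩
  ext
  · simp only [Prod.fst_add, Prod.smul_fst, smul_eq_mul]; field_simp; linarith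
  · simp only [Prod.snd_add, Prod.smul_snd, smul_eq_mul]; field_simp; linarith

/-- A vertex is not a proper weighted mean of two points of the hull. -/
theorem eq_of_weighted {n : ℕ} {z w₁ w₂ : ℝ × ℝ} {s t : ℝ} (hz : z ∈ hullVertices n)
    (h₁ : w₁ ∈ convexHull ℝ (hyperbolaRegion n ∩ integerLattice))
    (h₂ : w₂ ∈ convexHull ℝ (hyperbolaRegion n ∩ integerLattice)) (hs : 0 < s) (ht : 0 < t)
    (hx : (s + t) * z.1 = s * w₁.1 + t * w₂.1) (hy : (s + t) * z.2 = s * w₁.2 + t * w₂.2) :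
    w₁ = z := by
  have hst : 0 < s + t := by positivity
  refine hz.2 h₁ h₂ ⟨s / (s + t), t / (s + t), by positivity, by positivity, by field_simp, ?_⟩
  ext
  · simp only [Prod.fst_add, Prod.smul_fst, smul_eq_mul]; field_simp; linarith
  · simp only [Prod.snd_add, Prod.smul_snd, smul_eq_mul]; field_simp; linarith

/-- A vertex is the lowest point of the hull on its vertical line. -/
theorem le_of_mem_hullVertices {n : ℕ} {x y : ℤ} {y' : ℝ} (hz : toPlane (x, y) ∈ hullVertices n)
    (h : ((x : ℝ), y') ∈ convexHull ℝ (hyperbolaRegion n ∩ integerLattice)) : (y : ℝ) ≤ y' := by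
  by_contra hc
  push Not at hc
  obtain ⟨hx, hy, hxy⟩ := bounds_of_mem_hullVertices hz
  have h₂ : toPlane (x, y + 1) ∈ convexHull ℝ (hyperbolaRegion n ∩ integerLattice) :=
    mem_hull hx (by omega) (by linarith)
  -- The vertex would lie strictly between a lower point of the hull and the lattice point above it.
  have e := eq_of_weighted (s := 1) (t := y - y') hz h h₂ one_pos (by linarith)
    (by simp only [toPlane]; ring) (by simp only [toPlane]; push_cast; ring)
  have := congrArg Prod.snd e
  simp only [toPlane] at this
  linarith

theorem mul_pred_lt_of_mem_hullVertices {n : ℕ} (hn : 0 < n) {x y : ℤ}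
    (hz : toPlane (x, y) ∈ hullVertices n) : x * (y - 1) < n := by
  by_contra hc
  push Not at hc
  have hx := (bounds_of_mem_hullVertices hz).1
  have hy : 0 < y - 1 := pos_of_mul_pos_right (lt_of_lt_of_le (by exact_mod_cast hn) hc) hx
  have := le_of_mem_hullVertices hz (mem_hull hx hy.le hc)
  push_cast at this
  linarith

theorem pos_of_mem_hullVertices {n : ℕ} (hn : 0 < n) {x y : ℤ}
    (hz : toPlane (x, y) ∈ hullVertices n) : 0 < x ∧ 0 < y := by
  obtain ⟨hx, hy, hxy⟩ := bounds_of_mem_hullVertices hz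
  have : 0 < x * y := lt_of_lt_of_le (by exact_mod_cast hn) hxy
  exact ⟨pos_of_mul_pos_left this hy, pos_of_mul_pos_right this hx⟩

/-- A later vertex would also have ordinate 1, and would then be the midpoint of its two horizontal
lattice neighbours. -/
theorem laterAbscissas_eq_empty {n : ℕ} (hn : 0 < n) {a : ℤ}
    (hp : toPlane (a, 1) ∈ hullVertices n) : laterAbscissas n (toPlane (a, 1)) = ∅ := by
  rw [Set.eq_empty_iff_forall_notMem]
  rintro x' ⟨hx', y', hz⟩
  obtain ⟨x, y, e, -⟩ := exists_lattice_of_mem_hullVertices hz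
  obtain ⟨rfl, rfl⟩ := Prod.ext_iff.1 e
  change toPlane (x, y) ∈ _ at hz
  obtain ⟨ha, -, han⟩ := bounds_of_mem_hullVertices hp
  obtain ⟨hx, hy⟩ := pos_of_mem_hullVertices hn hz
  simp only [toPlane] at hx'
  have hax : a < x := by exact_mod_cast hx'
  have h1 := mul_pred_lt_of_mem_hullVertices hn hz
  obtain rfl : y = 1 := by
    by_contra hne
    have : 1 ≤ y - 1 := by omega
    nlinarith
  have e := eq_of_weighted (s := 1) (t := 1) hz
    (mem_hull (x := x - 1) (y := 1) (by omega) (by omega) (by omega))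
    (mem_hull (x := x + 1) (y := 1) (by omega) (by omega) (by omega)) one_pos one_pos
    (by simp only [toPlane]; push_cast; ring) (by simp only [toPlane]; push_cast; ring)
  have := congrArg Prod.fst e
  simp only [toPlane] at this
  push_cast at this
  linarith

/-- A point of a set that strictly minimizes a linear functional over the set is an extreme point
of the convex hull. -/
theorem mem_extremePoints_convexHull_of_lt {E : Type*} [AddCommGroup E] [Module ℝ E] {S : Set E}
    {q : E} (hq : q ∈ S) (φ : E →ₗ[ℝ] ℝ) (h : ∀ z ∈ S, z ≠ q → φ q < φ z) :
    q ∈ Set.extremePoints ℝ (convexHull ℝ S) := by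
  -- An open half-space together with one point of its boundary is convex.
  have hsub : convexHull ℝ S ⊆ {z | z = q ∨ φ q < φ z} := by
    refine convexHull_min (fun z hz => or_iff_not_imp_left.2 (h z hz)) ?_
    intro x hx y hy s t hs ht hst
    rcases hx with rfl | hx
    · rcases hy with rfl | hy
      · exact Or.inl (by rw [← add_smul, hst, one_smul])
      · rcases ht.eq_or_lt with rfl | ht
        · left; rw [zero_smul, add_zero, show s = 1 by linarith, one_smul]
        · right
          rw [map_add, map_smul, map_smul, smul_eq_mul, smul_eq_mul]
          obtain rfl : s = 1 - t := by linarith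
          nlinarith
    · rcases hs.eq_or_lt with rfl | hs
      · rw [zero_smul, zero_add, show t = 1 by linarith, one_smul]; exact hy
      · have hy' : φ q ≤ φ y := by
          rcases hy with rfl | hy
          exacts [le_rfl, hy.le]
        right
        rw [map_add, map_smul, map_smul, smul_eq_mul, smul_eq_mul]
        obtain rfl : t = 1 - s := by linarith
        nlinarith
  refine ⟨subset_convexHull ℝ _ hq, ?_⟩
  rintro x hx y hy ⟨s, t, hs, ht, hst, e⟩
  have hy' : φ q ≤ φ y := by
    rcases hsub hy with rfl | hy
    exacts [le_rfl, hy.le]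
  refine (hsub hx).resolve_right fun hx' => ?_
  have := congrArg φ e
  rw [map_add, map_smul, map_smul, smul_eq_mul, smul_eq_mul] at this
  obtain rfl : t = 1 - s := by linarith
  nlinarith

/-! ### The supporting line and the next vertex -/

section NextVertex

variable {n : ℕ} {a b u v k : ℤ}

/-- The line through a vertex with the steepest feasible direction supports the hull, and touches
it to the left of the vertex nowhere. -/
theorem support_line (hn : 0 < n) (hp : toPlane (a, b) ∈ hullVertices n) (hu : 0 < u)
    (hk : 0 < k) (hq : (n : ℤ) ≤ (a + k * u) * (b - k * v))
    (hst : ∀ d e, 0 < d → Feasible n a b d e → u * e ≤ v * d) {x y : ℤ} (hx : 0 ≤ x)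
    (hy : 0 ≤ y) (hxy : (n : ℤ) ≤ x * y) :
    v * a + u * b ≤ v * x + u * y ∧ (x < a → v * a + u * b < v * x + u * y) := by
  have hn' : (0 : ℤ) < n := by exact_mod_cast hn
  obtain ⟨ha, hb⟩ := pos_of_mem_hullVertices hn hp
  have hku : 0 < k * u := mul_pos hk hu
  rcases lt_trichotomy a x with hax | rfl | hax
  · refine ⟨?_, fun h => absurd h hax.not_gt⟩
    have := hst (x - a) (b - y) (by omega) (by
      unfold Feasible
      rwa [add_sub_cancel, sub_sub_cancel])
    linarith
  · refine ⟨?_, fun h => absurd h (lt_irrefl _)⟩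
    have h1 := mul_pred_lt_of_mem_hullVertices hn hp
    have : b ≤ y := by
      by_contra hc
      nlinarith [mul_le_mul_of_nonneg_left (by omega : y ≤ b - 1) hx]
    have := mul_le_mul_of_nonneg_left this hu.le
    omega
  · suffices h : v * a + u * b < v * x + u * y from ⟨h.le, fun _ => h⟩
    by_contra hc
    push Not at hc
    have hqm : toPlane (a + k * u, b - k * v) ∈
        convexHull ℝ (hyperbolaRegion n ∩ integerLattice) :=
      mem_hull (by omega) (pos_of_mul_pos_right (hn'.trans_le hq) (by omega)).le hq
    have hzm := mem_hull hx hy hxy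
    have hku' : (0 : ℝ) < k * u := by exact_mod_cast hku
    have hax' : (0 : ℝ) < a - x := by exact_mod_cast sub_pos.2 hax
    have hk' : (0 : ℝ) < k := by exact_mod_cast hk
    have hc' : (v * x + u * y : ℝ) ≤ v * a + u * b := by exact_mod_cast hc
    have hpos : (0 : ℝ) < k * u + (a - x) := by linarith
    -- The segment from (x, y) to the far point crosses the vertical line through p. As p is lowest
    -- there, (x, y) must lie on the supporting line, and then p is a proper mean of two hull
    -- points.
    have hw := weighted_mem_hull (s := k * u) (t := a - x) (x := a)
      (y := (k * u * y + (a - x) * (b - k * v)) / (k * u + (a - x))) hzm hqm hku' hax'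
      (by simp only [toPlane]; push_cast; ring)
      (by simp only [toPlane]; push_cast; field_simp)
    have hle := le_of_mem_hullVertices hp hw
    rw [le_div_iff₀ hpos] at hle
    have heq : (v * x + u * y : ℝ) = v * a + u * b := by
      refine le_antisymm hc' (le_of_mul_le_mul_left ?_ hk')
      linarith
    have e := eq_of_weighted (s := k * u) (t := a - x) hp hzm hqm hku' hax'
      (by simp only [toPlane]; push_cast; ring)
      (by simp only [toPlane]; push_cast; linear_combination (-(k : ℝ)) * heq)
    have := congrArg Prod.fst e
    simp only [toPlane] at this
    linarith

/-- The supporting functional v x + u y may be minimal at several points. A small perturbation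
favouring large x makes the far end its unique minimizer among the lattice points. -/
theorem end_mem_hullVertices (hn : 0 < n) (hp : toPlane (a, b) ∈ hullVertices n) (hu : 0 < u)
    (hv : 0 < v) (huv : IsCoprime u v) (hk : 0 < k)
    (hq : (n : ℤ) ≤ (a + k * u) * (b - k * v))
    (hmax : ∀ i, (n : ℤ) ≤ (a + i * u) * (b - i * v) → i ≤ k)
    (hst : ∀ d e, 0 < d → Feasible n a b d e → u * e ≤ v * d) :
    toPlane (a + k * u, b - k * v) ∈ hullVertices n := by
  have hn' : (0 : ℤ) < n := by exact_mod_cast hn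
  obtain ⟨ha, hb⟩ := pos_of_mem_hullVertices hn hp
  have hku : 0 < k * u := mul_pos hk hu
  -- This scale suffices: off the line the integer functional grows by at least 1, and x never
  -- exceeds it because v ≥ 1.
  let N : ℤ := v * a + u * b + 1
  let φ : ℝ × ℝ →ₗ[ℝ] ℝ :=
    ((N * v - 1 : ℤ) : ℝ) • LinearMap.fst ℝ ℝ ℝ + ((N * u : ℤ) : ℝ) • LinearMap.snd ℝ ℝ ℝ
  have hφ : ∀ z : ℤ × ℤ, φ (toPlane z) = ((N * (v * z.1 + u * z.2) - z.1 : ℤ) : ℝ) := by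
    intro z
    simp only [φ, toPlane, LinearMap.add_apply, LinearMap.smul_apply, LinearMap.fst_apply,
      LinearMap.snd_apply, smul_eq_mul]
    push_cast; ring
  refine mem_extremePoints_convexHull_of_lt (φ := φ)
    ⟨toPlane_mem_hyperbolaRegion.2
      ⟨by dsimp only; omega, (pos_of_mul_pos_right (hn'.trans_le hq) (by omega)).le, hq⟩,
      _, rfl⟩ ?_
  rintro _ ⟨hz, ⟨x, y⟩, rfl⟩ hne
  obtain ⟨hx, hy, hxy⟩ := toPlane_mem_hyperbolaRegion.1 hz
  dsimp only at hx hy hxy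
  rw [hφ, hφ, Int.cast_lt]
  dsimp only
  obtain ⟨hs, hleft⟩ := support_line hn hp hu hk hq hst hx hy hxy
  have eq0 : v * (a + k * u) + u * (b - k * v) = v * a + u * b := by ring
  rw [eq0]
  have hl : 0 < v * a + u * b := by positivity
  rcases hs.eq_or_lt with h | h
  · rw [← h]
    suffices x < a + k * u by omega
    rcases le_or_gt x a with hxa | hxa
    · omega
    -- Coprimality puts the lattice points of the line at integer multiples of (u, v), so `hmax`
    -- applies.
    · have hdvd : u ∣ x - a := by
        refine huv.dvd_of_dvd_mul_left (⟨b - y, ?_⟩ : u ∣ v * (x - a))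
        linear_combination -h
      obtain ⟨c, hc⟩ := hdvd
      obtain rfl : x = a + c * u := by linear_combination hc
      obtain rfl : y = b - c * v := by
        refine mul_left_cancel₀ hu.ne' ?_
        linear_combination -h
      have hck := hmax c hxy
      have : c ≠ k := by rintro rfl; exact hne rfl
      have := mul_lt_mul_of_pos_right (by omega : c < k) hu
      omega
  · have h1 : x ≤ v * x := le_mul_of_one_le_left hx (by omega)
    have h2 : 0 ≤ u * y := by positivity
    have h3 := mul_le_mul_of_nonneg_left (by omega : v * a + u * b + 1 ≤ v * x + u * y) hl.le
    simp only [N]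
    linarith

/-- From a vertex, the farthest lattice point above the hyperbola in the steepest feasible
direction is the next vertex. -/
theorem isNextVertex_of_steepest (hn : 0 < n) (hp : toPlane (a, b) ∈ hullVertices n)
    (hu : 0 < u) (hv : 0 < v) (huv : IsCoprime u v) (hk : 0 < k)
    (hq : (n : ℤ) ≤ (a + k * u) * (b - k * v))
    (hmax : ∀ i, (n : ℤ) ≤ (a + i * u) * (b - i * v) → i ≤ k)
    (hst : ∀ d e, 0 < d → Feasible n a b d e → u * e ≤ v * d) :
    IsNextVertex n (toPlane (a, b)) (toPlane (a + k * u, b - k * v)) := by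
  have hqv := end_mem_hullVertices hn hp hu hv huv hk hq hmax hst
  have hku : 0 < k * u := mul_pos hk hu
  refine ⟨hqv, ⟨?_, _, hqv⟩, ?_⟩
  · simp only [toPlane]
    exact_mod_cast (by omega : a < a + k * u)
  · rintro x' ⟨hx', y', hz⟩
    obtain ⟨x, y, e, hx, hy, hxy⟩ := exists_lattice_of_mem_hullVertices hz
    obtain ⟨rfl, rfl⟩ := Prod.ext_iff.1 e
    change toPlane (x, y) ∈ _ at hz
    by_contra hc
    push Not at hc
    simp only [toPlane] at hc hx'
    have hs := (support_line hn hp hu hk hq hst hx hy hxy).1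
    have hs' : (v * a + u * b : ℝ) ≤ v * x + u * y := by exact_mod_cast hs
    have hu' : (0 : ℝ) < u := by exact_mod_cast hu
    have hk' : (0 : ℝ) < k := by exact_mod_cast hk
    push_cast at hc
    have hs1 : (0 : ℝ) < a + k * u - x := by linarith
    have ht1 : (0 : ℝ) < x - a := by linarith
    -- A vertex strictly between would be on or below the chord from p to the far end, hence on it,
    -- since the chord lies on the supporting line. It would then be a proper mean of the endpoints.
    have hw := weighted_mem_hull (s := a + k * u - x) (t := x - a) (x := x)
      (y := (u * b - (x - a) * v) / u) hp.1 hqv.1 hs1 ht1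
      (by simp only [toPlane]; push_cast; ring)
      (by simp only [toPlane]; push_cast; field_simp; ring)
    have hle := le_of_mem_hullVertices hz hw
    rw [le_div_iff₀ hu'] at hle
    have heq : (v * a + u * b : ℝ) = v * x + u * y := by linarith
    have e := eq_of_weighted (s := a + k * u - x) (t := x - a) hz hp.1 hqv.1 hs1 ht1
      (by simp only [toPlane]; push_cast; ring)
      (by simp only [toPlane]; push_cast; linear_combination (-(k : ℝ)) * heq)
    have := congrArg Prod.fst e
    simp only [toPlane] at this
    linarith

end NextVertex

/-! ## Execution of programs -/

namespace RAM

section Steps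

variable {P : Program} {pc t d a b l : ℕ} {k : ℤ} {M : ℕ → ℤ}

theorem run_succ {c c' : Config} {i : Instr} (h : P[c.pc]? = some i)
    (h' : exec c i = some c') : run P (t + 1) c = run P t c' := by
  rw [run, step, h, Option.bind_some, h', Option.bind_some]

theorem run_const (h : P[pc]? = some (.const d k)) :
    run P (t + 1) ⟨pc, M⟩ = run P t ⟨pc + 1, Function.update M d k⟩ :=
  run_succ h rfl

theorem run_copy (h : P[pc]? = some (.copy d a)) :
    run P (t + 1) ⟨pc, M⟩ = run P t ⟨pc + 1, Function.update M d (M a)⟩ :=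
  run_succ h rfl

theorem run_add (h : P[pc]? = some (.add d a b)) :
    run P (t + 1) ⟨pc, M⟩ = run P t ⟨pc + 1, Function.update M d (M a + M b)⟩ :=
  run_succ h rfl

theorem run_sub (h : P[pc]? = some (.sub d a b)) :
    run P (t + 1) ⟨pc, M⟩ = run P t ⟨pc + 1, Function.update M d (M a - M b)⟩ :=
  run_succ h rfl

theorem run_mul (h : P[pc]? = some (.mul d a b)) :
    run P (t + 1) ⟨pc, M⟩ = run P t ⟨pc + 1, Function.update M d (M a * M b)⟩ :=
  run_succ h rfl

theorem run_div (h : P[pc]? = some (.div d a b)) (hb : M b ≠ 0) :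
    run P (t + 1) ⟨pc, M⟩ = run P t ⟨pc + 1, Function.update M d (Int.fdiv (M a) (M b))⟩ :=
  run_succ h (if_neg hb)

theorem run_sqrt (h : P[pc]? = some (.sqrt d a)) (ha : 0 ≤ M a) :
    run P (t + 1) ⟨pc, M⟩ = run P t ⟨pc + 1, Function.update M d (Int.sqrt (M a))⟩ :=
  run_succ h (if_neg ha.not_gt)

theorem run_jump (h : P[pc]? = some (.jump l)) : run P (t + 1) ⟨pc, M⟩ = run P t ⟨l, M⟩ :=
  run_succ h rfl

theorem run_jumpLt (h : P[pc]? = some (.jumpLt a b l)) :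
    run P (t + 1) ⟨pc, M⟩ = run P t ⟨if M a < M b then l else pc + 1, M⟩ :=
  run_succ h rfl

theorem run_jumpEq (h : P[pc]? = some (.jumpEq a b l)) :
    run P (t + 1) ⟨pc, M⟩ = run P t ⟨if M a = M b then l else pc + 1, M⟩ :=
  run_succ h rfl

theorem run_trans {s : ℕ} {c c' : Config} (h : run P s c = some c') :
    run P (s + t) c = run P t c' := by
  induction s generalizing c with
  | zero => obtain rfl : c = c' := Option.some.inj h; rw [zero_add]
  | succ s ih =>
    rw [Nat.add_right_comm, run]
    rw [run] at h
    cases hc : step P c with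
    | none => rw [hc] at h; simp at h
    | some c₁ => rw [hc, Option.bind_some] at h; rw [Option.bind_some, ih h]

/-- From the configuration `c`, the program halts within `t` steps and outputs `output`. -/
def HaltsFrom (P : Program) (c : Config) (t : ℕ) (output : List ℤ) : Prop :=
  ∃ s ≤ t, ∃ c', run P s c = some c' ∧ P[c'.pc]? = some .halt ∧
    ∀ i (hi : i < output.length), c'.mem i = output[i]

theorem HaltsFrom.of_run {s : ℕ} {c c' : Config} {output : List ℤ}
    (h' : HaltsFrom P c' t output) (h : run P s c = some c') : HaltsFrom P c (s + t) output := by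
  obtain ⟨r, hr, c₁, h₁, h₂⟩ := h'
  exact ⟨s + r, by omega, c₁, (run_trans h).trans h₁, h₂⟩

theorem HaltsFrom.mono {s : ℕ} {c : Config} {output : List ℤ}
    (h : HaltsFrom P c s output) (hst : s ≤ t) : HaltsFrom P c t output :=
  let ⟨r, hr, h⟩ := h
  ⟨r, hr.trans hst, h⟩

end Steps

/-! ## The program -/

/-- For the cells `(x, y)` of a point and `(u, v)` of a direction, compute the quadratic polynomial
whose roots are the parameters `k` with `(x + k u) (y - k v) = n`: twice the leading
coefficient goes to cell `13`, the negated linear coefficient to cell `14` and the discriminant to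
cell `15`. -/
def quadratic (x y u v : ℕ) : Program :=
  [.mul 11 u v, .add 13 11 11, .mul 14 y u, .mul 12 x v, .sub 14 14 12, .mul 12 x y, .sub 12 0 12,
    .mul 15 13 12, .add 15 15 15, .mul 12 14 14, .sub 15 12 15]

/-- The program that computes the next vertex. Cells: `n` in `0`, the vertex in `1, 2`, the
constant `1` in `3`, the feasible direction in `4, 5`, the infeasible direction in `6, 7`, the
constant `0` in `10`. -/
def nextVertex : Program :=
  [.const 3 1, .jumpEq 2 3 84, .const 4 1, .const 7 1, .sub 8 0 3, .sub 9 2 3, .div 6 8 9,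
    .sub 6 6 1, .jumpLt 10 6 43, .add 11 1 3, .div 11 8 11, .sub 5 9 11] ++
  ([.add 8 1 6, .sub 9 2 7] ++ quadratic 8 9 4 5 ++
    [.jumpLt 15 10 64, .sqrt 15 15, .sub 14 14 15, .sub 14 14 3, .div 14 14 13, .jumpLt 14 10 64,
      .mul 11 14 4, .add 8 6 11, .mul 11 14 5, .add 9 7 11, .add 11 1 8, .add 11 11 4,
      .sub 12 2 9, .sub 12 12 5, .mul 11 11 12, .jumpLt 11 0 64, .copy 6 8, .copy 7 9]) ++
  ([.add 8 1 4, .sub 9 2 5] ++ quadratic 8 9 6 7 ++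
    [.sqrt 15 15, .add 14 14 15, .div 14 14 13, .mul 11 14 6, .add 4 4 11, .mul 11 14 7,
      .add 5 5 11, .jump 12]) ++
  (quadratic 1 2 4 5 ++
    [.sqrt 15 15, .add 14 14 15, .div 14 14 13, .mul 11 14 4, .add 1 1 11, .mul 11 14 5,
      .sub 2 2 11, .copy 0 3, .halt]) ++
  [.const 0 0, .halt]

/-- Only scratch cells above 10 are written, so the state held in the cells up to 10 survives. -/
theorem run_quadratic {P : Program} {pc x y u v : ℕ} (hx : x ≤ 10) (hy : y ≤ 10) (hu : u ≤ 10)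
    (hv : v ≤ 10) (hP : ∀ i < 11, P[pc + i]? = (quadratic x y u v)[i]?) (M : ℕ → ℤ) :
    ∃ M', run P 11 ⟨pc, M⟩ = some ⟨pc + 11, M'⟩ ∧ (∀ c ≤ 10, M' c = M c) ∧
      M' 13 = M u * M v + M u * M v ∧ M' 14 = M y * M u - M x * M v ∧
      M' 15 = M' 14 * M' 14 - (M' 13 * (M 0 - M x * M y) + M' 13 * (M 0 - M x * M y)) := by
  have ne : ∀ z ≤ 10, z ≠ 11 ∧ z ≠ 12 ∧ z ≠ 13 ∧ z ≠ 14 ∧ z ≠ 15 := by omega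
  obtain ⟨M₁, r₁, e₁, h13, h14⟩ : ∃ M₁, run P 5 ⟨pc, M⟩ = some ⟨pc + 5, M₁⟩ ∧
      (∀ c ≤ 10, M₁ c = M c) ∧ M₁ 13 = M u * M v + M u * M v ∧
      M₁ 14 = M y * M u - M x * M v := by
    refine ⟨_, (run_mul (hP 0 (by norm_num))).trans <| (run_add (hP 1 (by norm_num))).trans <|
      (run_mul (hP 2 (by norm_num))).trans <| (run_mul (hP 3 (by norm_num))).trans <|
      (run_sub (hP 4 (by norm_num))).trans rfl, ?_, ?_, ?_⟩
    · intro c hc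
      simp only [Function.update_apply, ne c hc, if_false]
    · simp
    · simp [ne x hx, ne y hy, ne u hu, ne v hv]
  obtain ⟨M₂, r₂, e₂, h12, h13', h14'⟩ : ∃ M₂, run P 2 ⟨pc + 5, M₁⟩ = some ⟨pc + 7, M₂⟩ ∧
      (∀ c ≤ 10, M₂ c = M c) ∧ M₂ 12 = M 0 - M x * M y ∧ M₂ 13 = M₁ 13 ∧ M₂ 14 = M₁ 14 := by
    refine ⟨_, (run_mul (hP 5 (by norm_num))).trans <| (run_sub (hP 6 (by norm_num))).trans rfl,
      ?_, ?_, ?_, ?_⟩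
    · intro c hc
      simp only [Function.update_apply, ne c hc, if_false, e₁ c hc]
    · simp [e₁]
      rw [e₁ x hx, e₁ y hy]
    · simp
    · simp
  have r₃ := (run_mul (M := M₂) (t := 3) (hP 7 (by norm_num))).trans <|
    (run_add (hP 8 (by norm_num))).trans <| (run_mul (hP 9 (by norm_num))).trans <|
    (run_sub (hP 10 (by norm_num))).trans rfl
  refine ⟨_, (run_trans (t := 6) r₁).trans ((run_trans (t := 4) r₂).trans r₃), ?_, ?_, ?_, ?_⟩
  · intro c hc
    simp only [Function.update_apply, ne c hc, if_false, e₂ c hc]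
  · simp [h13, h13']
  · simp [h14, h14']
  · simp [h12]

/-- The contents of the main cells. -/
structure Stores (n a b lx ly rx ry : ℤ) (M : ℕ → ℤ) : Prop where
  cell0 : M 0 = n
  cell1 : M 1 = a
  cell2 : M 2 = b
  cell3 : M 3 = 1
  cell4 : M 4 = lx
  cell5 : M 5 = ly
  cell6 : M 6 = rx
  cell7 : M 7 = ry
  cell10 : M 10 = 0

variable {n a b lx ly rx ry : ℤ} {M : ℕ → ℤ}


theorem Stores.of_eq {M' : ℕ → ℤ} (h : Stores n a b lx ly rx ry M)
    (e : ∀ c ≤ 10, M' c = M c) : Stores n a b lx ly rx ry M' where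
  cell0 := (e 0 (by norm_num)).trans h.cell0
  cell1 := (e 1 (by norm_num)).trans h.cell1
  cell2 := (e 2 (by norm_num)).trans h.cell2
  cell3 := (e 3 (by norm_num)).trans h.cell3
  cell4 := (e 4 (by norm_num)).trans h.cell4
  cell5 := (e 5 (by norm_num)).trans h.cell5
  cell6 := (e 6 (by norm_num)).trans h.cell6
  cell7 := (e 7 (by norm_num)).trans h.cell7
  cell10 := (e 10 (by norm_num)).trans h.cell10

/-- The coefficients left behind by `quadratic`. -/
structure Coefficients (n x y u v : ℤ) (M : ℕ → ℤ) : Prop where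
  cell13 : M 13 = u * v + u * v
  cell14 : M 14 = y * u - x * v
  cell15 : M 15 = M 14 * M 14 - (M 13 * (n - x * y) + M 13 * (n - x * y))

/-! ### Effects of the program blocks on the bracket -/

theorem run_left_quadratic (h : Stores n a b lx ly rx ry M) :
    ∃ M', run nextVertex 13 ⟨43, M⟩ = some ⟨56, M'⟩ ∧ Stores n a b lx ly rx ry M' ∧
      Coefficients n (a + lx) (b - ly) rx ry M' := by
  obtain ⟨M₁, r₁, s₁, hx, hy⟩ : ∃ M₁, run nextVertex 2 ⟨43, M⟩ = some ⟨45, M₁⟩ ∧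
      Stores n a b lx ly rx ry M₁ ∧ M₁ 8 = a + lx ∧ M₁ 9 = b - ly := by
    refine ⟨_, (run_add rfl).trans <| (run_sub rfl).trans rfl, ?_, ?_, ?_⟩
    · constructor <;> simp [h.1, h.2, h.3, h.4, h.5, h.6, h.7, h.8, h.9]
    · simp [h.cell1, h.cell4]
    · simp [h.cell2, h.cell5]
  obtain ⟨M₂, r₂, e, e13, e14, e15⟩ := run_quadratic (P := nextVertex) (pc := 45)
    (x := 8) (y := 9) (u := 6) (v := 7) (by norm_num) (by norm_num) (by norm_num) (by norm_num)
    (fun i hi => by interval_cases i <;> rfl) M₁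
  rw [hx, hy, s₁.cell0] at e15
  rw [hx, hy, s₁.cell6, s₁.cell7] at e14
  rw [s₁.cell6, s₁.cell7] at e13
  exact ⟨M₂, (run_trans (t := 11) r₁).trans r₂, s₁.of_eq e, e13, e14, e15⟩

theorem run_right_quadratic (h : Stores n a b lx ly rx ry M) :
    ∃ M', run nextVertex 13 ⟨12, M⟩ = some ⟨25, M'⟩ ∧ Stores n a b lx ly rx ry M' ∧
      Coefficients n (a + rx) (b - ry) lx ly M' := by
  obtain ⟨M₁, r₁, s₁, hx, hy⟩ : ∃ M₁, run nextVertex 2 ⟨12, M⟩ = some ⟨14, M₁⟩ ∧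
      Stores n a b lx ly rx ry M₁ ∧ M₁ 8 = a + rx ∧ M₁ 9 = b - ry := by
    refine ⟨_, (run_add rfl).trans <| (run_sub rfl).trans rfl, ?_, ?_, ?_⟩
    · constructor <;> simp [h.1, h.2, h.3, h.4, h.5, h.6, h.7, h.8, h.9]
    · simp [h.cell1, h.cell6]
    · simp [h.cell2, h.cell7]
  obtain ⟨M₂, r₂, e, e13, e14, e15⟩ := run_quadratic (P := nextVertex) (pc := 14)
    (x := 8) (y := 9) (u := 4) (v := 5) (by norm_num) (by norm_num) (by norm_num) (by norm_num)
    (fun i hi => by interval_cases i <;> rfl) M₁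
  rw [hx, hy, s₁.cell0] at e15
  rw [hx, hy, s₁.cell4, s₁.cell5] at e14
  rw [s₁.cell4, s₁.cell5] at e13
  exact ⟨M₂, (run_trans (t := 11) r₁).trans r₂, s₁.of_eq e, e13, e14, e15⟩

theorem run_final_quadratic (h : Stores n a b lx ly rx ry M) :
    ∃ M', run nextVertex 11 ⟨64, M⟩ = some ⟨75, M'⟩ ∧ Stores n a b lx ly rx ry M' ∧
      Coefficients n a b lx ly M' := by
  obtain ⟨M₂, r₂, e, e13, e14, e15⟩ := run_quadratic (P := nextVertex) (pc := 64)
    (x := 1) (y := 2) (u := 4) (v := 5) (by norm_num) (by norm_num) (by norm_num) (by norm_num)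
    (fun i hi => by interval_cases i <;> rfl) M
  rw [h.cell0, h.cell1, h.cell2] at e15
  rw [h.cell1, h.cell2, h.cell4, h.cell5] at e14
  rw [h.cell4, h.cell5] at e13
  exact ⟨M₂, r₂, h.of_eq e, e13, e14, e15⟩

theorem run_left_move (h : Stores n a b lx ly rx ry M) (hA : M 13 ≠ 0) (hD : 0 ≤ M 15) {k : ℤ}
    (hk : k = Int.fdiv (M 14 + Int.sqrt (M 15)) (M 13)) :
    ∃ M', run nextVertex 8 ⟨56, M⟩ = some ⟨12, M'⟩ ∧
      Stores n a b (lx + k * rx) (ly + k * ry) rx ry M' := by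
  refine ⟨_, (run_sqrt rfl hD).trans <| (run_add rfl).trans <|
    (run_div rfl (by simpa using hA)).trans <| (run_mul rfl).trans <| (run_add rfl).trans <|
    (run_mul rfl).trans <| (run_add rfl).trans <| (run_jump rfl).trans rfl, ?_⟩
  constructor <;> simp [h.1, h.2, h.3, h.4, h.5, h.6, h.7, h.8, h.9, hk]

theorem run_final_move (h : Stores n a b lx ly rx ry M) (hA : M 13 ≠ 0) (hD : 0 ≤ M 15) {k : ℤ}
    (hk : k = Int.fdiv (M 14 + Int.sqrt (M 15)) (M 13)) :
    ∃ M', run nextVertex 8 ⟨75, M⟩ = some ⟨83, M'⟩ ∧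
      M' 0 = 1 ∧ M' 1 = a + k * lx ∧ M' 2 = b - k * ly := by
  refine ⟨_, (run_sqrt rfl hD).trans <| (run_add rfl).trans <|
    (run_div rfl (by simpa using hA)).trans <| (run_mul rfl).trans <| (run_add rfl).trans <|
    (run_mul rfl).trans <| (run_sub rfl).trans <| (run_copy rfl).trans rfl, ?_, ?_, ?_⟩ <;>
  simp [h.2, h.3, h.4, h.5, h.6, hk]

theorem run_right_root (h : Stores n a b lx ly rx ry M) (hA : M 13 ≠ 0) (hD : 0 ≤ M 15) :
    ∃ M', run nextVertex 5 ⟨25, M⟩ = some ⟨30, M'⟩ ∧ Stores n a b lx ly rx ry M' ∧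
      M' 14 = Int.fdiv (M 14 - Int.sqrt (M 15) - 1) (M 13) := by
  refine ⟨_, ((run_jumpLt rfl).trans (by rw [if_neg (by rw [h.cell10]; exact hD.not_gt)])).trans <|
    (run_sqrt rfl hD).trans <| (run_sub rfl).trans <| (run_sub rfl).trans <|
    (run_div rfl (by simpa using hA)).trans rfl, ?_, ?_⟩
  · constructor <;> simp [h.1, h.2, h.3, h.4, h.5, h.6, h.7, h.8, h.9]
  · simp [h.cell3]

theorem run_right_test (h : Stores n a b lx ly rx ry M) {m : ℤ} (hm : M 14 = m) (hm0 : 0 ≤ m) :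
    ∃ M', run nextVertex 10 ⟨30, M⟩ = some ⟨40, M'⟩ ∧ Stores n a b lx ly rx ry M' ∧
      M' 8 = rx + m * lx ∧ M' 9 = ry + m * ly ∧
      M' 11 = (a + (rx + m * lx) + lx) * (b - (ry + m * ly) - ly) := by
  refine ⟨_, ((run_jumpLt rfl).trans
      (by rw [if_neg (by rw [h.cell10, hm]; exact hm0.not_gt)])).trans <|
    (run_mul rfl).trans <| (run_add rfl).trans <| (run_mul rfl).trans <| (run_add rfl).trans <|
    (run_add rfl).trans <| (run_add rfl).trans <| (run_sub rfl).trans <| (run_sub rfl).trans <|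
    (run_mul rfl).trans rfl, ?_, ?_, ?_, ?_⟩
  · constructor <;> simp [h.1, h.2, h.3, h.4, h.5, h.6, h.7, h.8, h.9]
  all_goals simp [h.2, h.3, h.5, h.6, h.7, h.8, hm]

theorem run_right_move (h : Stores n a b lx ly rx ry M) (h11 : n ≤ M 11) :
    ∃ M', run nextVertex 3 ⟨40, M⟩ = some ⟨43, M'⟩ ∧
      Stores n a b lx ly (M 8) (M 9) M' := by
  refine ⟨_, ((run_jumpLt rfl).trans (by rw [if_neg (by rw [h.cell0]; exact h11.not_gt)])).trans <|
    (run_copy rfl).trans <| (run_copy rfl).trans rfl, ?_⟩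
  constructor <;> simp [h.1, h.2, h.3, h.4, h.5, h.6, h.9]

/-- One move of the feasible direction. -/
theorem run_left (h : Stores n a b lx ly rx ry M)
    (hR : SlopeBracket n a b lx ly rx ry) (hrx : 0 < rx)
    (hS : Feasible n a b (lx + rx) (ly + ry)) :
    ∃ lx' ly' M', run nextVertex 21 ⟨43, M⟩ = some ⟨12, M'⟩ ∧ ly + ry ≤ ly' ∧
      SlopeBracket n a b lx' ly' rx ry ∧ ¬ Feasible n a b (lx' + rx) (ly' + ry) ∧
      Stores n a b lx' ly' rx ry M' := by
  obtain ⟨M₁, r₁, s₁, c⟩ := run_left_quadratic h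
  have huv : 0 < rx * ry := mul_pos hrx hR.ry_pos
  have feas : ∀ i, Feasible n a b (lx + i * rx) (ly + i * ry) ↔
      n ≤ (a + lx + i * rx) * (b - ly - i * ry) := by
    intro i; rw [Feasible, add_assoc, sub_sub]
  obtain ⟨hD, hk, hf, hmax⟩ := largest_parameter (k₀ := 1) huv c.cell13 c.cell14 c.cell15
    ((feas 1).1 (by rwa [one_mul, one_mul]))
  obtain ⟨k, hkdef⟩ : ∃ k, k = Int.fdiv (M₁ 14 + Int.sqrt (M₁ 15)) (M₁ 13) := ⟨_, rfl⟩
  obtain ⟨M₂, r₂, s₂⟩ := run_left_move s₁ (by rw [c.cell13]; omega) hD hkdef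
  rw [← hkdef] at hk hf hmax
  have hry := hR.ry_pos
  refine ⟨_, _, M₂, (run_trans (t := 8) r₁).trans r₂, ?_,
    hR.move_left (by omega) ((feas k).2 hf), ?_, s₂⟩
  · nlinarith
  · intro hc
    have := hmax (k + 1) ((feas (k + 1)).1 (by
      rwa [add_one_mul, add_one_mul, ← add_assoc, ← add_assoc]))
    omega

/-- The final part of the program, for the steepest feasible direction. -/
theorem halts_final (h : Stores n a b lx ly rx ry M) (hlx : 0 < lx) (hly : 0 < ly)
    (hL : Feasible n a b lx ly) :
    ∃ k, 0 < k ∧ n ≤ (a + k * lx) * (b - k * ly) ∧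
      (∀ i, n ≤ (a + i * lx) * (b - i * ly) → i ≤ k) ∧
      HaltsFrom nextVertex ⟨64, M⟩ 19 [1, a + k * lx, b - k * ly] := by
  obtain ⟨M₁, r₁, s₁, c⟩ := run_final_quadratic h
  have huv : 0 < lx * ly := mul_pos hlx hly
  obtain ⟨hD, hk, hf, hmax⟩ := largest_parameter (k₀ := 1) huv c.cell13 c.cell14 c.cell15
    (by rwa [one_mul, one_mul])
  obtain ⟨M₂, r₂, h0, h1, h2⟩ := run_final_move s₁ (by rw [c.cell13]; omega) hD rfl
  refine ⟨_, by omega, hf, hmax, 19, le_rfl, _, (run_trans (t := 8) r₁).trans r₂, rfl, ?_⟩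
  intro i hi
  simp only [List.length_cons, List.length_nil] at hi
  interval_cases i
  exacts [h0, h1, h2]

/-- One move of the infeasible direction, or the end of the search. -/
theorem run_right (h : Stores n a b lx ly rx ry M) (hR : SlopeBracket n a b lx ly rx ry)
    (hly : 0 < ly) (hS : ¬ Feasible n a b (lx + rx) (ly + ry)) :
    ∃ s ≤ 31, ∃ M',
      (run nextVertex s ⟨12, M⟩ = some ⟨64, M'⟩ ∧ Stores n a b lx ly rx ry M' ∧
        ∀ i > 0, ¬ Feasible n a b (rx + i * lx) (ry + i * ly)) ∨
      ∃ m, run nextVertex s ⟨12, M⟩ = some ⟨43, M'⟩ ∧ 0 < m ∧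
        Stores n a b lx ly (rx + m * lx) (ry + m * ly) M' ∧
        SlopeBracket n a b lx ly (rx + m * lx) (ry + m * ly) ∧
        Feasible n a b (lx + (rx + m * lx)) (ly + (ry + m * ly)) := by
  obtain ⟨M₁, r₁, s₁, c⟩ := run_right_quadratic h
  have huv : 0 < lx * ly := mul_pos hR.lx_pos hly
  have feas : ∀ i, Feasible n a b (rx + i * lx) (ry + i * ly) ↔
      n ≤ (a + rx + i * lx) * (b - ry - i * ly) := by
    intro i; rw [Feasible, add_assoc, sub_sub]
  have feas0 := hR.right
  rw [show rx = rx + 0 * lx by ring, show ry = ry + 0 * ly by ring, feas] at feas0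
  rcases lt_or_ge (M₁ 15) 0 with hD | hD
  · refine ⟨13 + 1, by norm_num, M₁, Or.inl ⟨(run_trans r₁).trans
      ((run_jumpLt rfl).trans ?_), s₁, fun i _ => ?_⟩⟩
    · rw [if_pos (by rwa [s₁.cell10])]; rfl
    · rw [feas]; exact no_parameter_of_neg huv c.cell13 c.cell14 c.cell15 hD i
  obtain ⟨M₂, r₂, s₂, hm⟩ := run_right_root s₁ (by rw [c.cell13]; omega) hD
  obtain ⟨m, hmdef⟩ : ∃ m, M₂ 14 = m := ⟨_, rfl⟩
  rw [hmdef] at hm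
  obtain ⟨hlow, hhigh⟩ := smallest_parameter huv c.cell13 c.cell14 c.cell15 hD hm
  have r₂' := (run_trans (t := 5) r₁).trans r₂
  -- If m < 0, then 0 is beyond m, and a feasible R + i L with i > 0 would make R itself feasible.
  rcases lt_or_ge m 0 with hm0 | hm0
  · refine ⟨18 + 1, by norm_num, M₂, Or.inl ⟨(run_trans r₂').trans
      ((run_jumpLt rfl).trans ?_), s₂, fun i hi hc => ?_⟩⟩
    · rw [if_pos (by rwa [s₂.cell10, hmdef])]; rfl
    · exact feas0 (hhigh 0 i hm0 hi.le ((feas i).1 hc))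
  obtain ⟨M₃, r₃, s₃, h8, h9, h11⟩ := run_right_test s₂ hmdef hm0
  have r₃' := (run_trans (t := 10) r₂').trans r₃
  have h11' : M₃ 11 = (a + rx + (m + 1) * lx) * (b - ry - (m + 1) * ly) := by rw [h11]; ring
  -- Whether any parameter is good is decided at m + 1: the real roots may enclose no integer.
  rcases lt_or_ge (M₃ 11) n with hlt | hge
  · refine ⟨28 + 1, by norm_num, M₃, Or.inl ⟨(run_trans r₃').trans
      ((run_jumpLt rfl).trans ?_), s₃, fun i hi hc => ?_⟩⟩
    · rw [if_pos (by rwa [s₃.cell0])]; rfl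
    · have hc' := (feas i).1 hc
      rcases le_or_gt i m with him | him
      · exact hlow i him hc'
      · have := hhigh (m + 1) i (by omega) (by omega) hc'
        omega
  · obtain ⟨M₄, r₄, s₄⟩ := run_right_move s₃ hge
    rw [h8, h9] at s₄
    rw [h11'] at hge
    -- For m = 0 the direction L + R would be feasible, against the maximality of L. The doubling
    -- needs m ≥ 1.
    have hm1 : m ≠ 0 := by
      rintro rfl
      apply hS
      have := (feas (0 + 1)).2 hge
      rwa [zero_add, one_mul, one_mul, add_comm, add_comm ry] at this
    refine ⟨28 + 3, by norm_num, M₄, Or.inr ⟨m, (run_trans r₃').trans r₄, by omega, s₄,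
      hR.move_right hm0 fun i hi => by rw [feas]; exact hlow i hi, ?_⟩⟩
    have := (feas (m + 1)).2 hge
    rwa [show rx + (m + 1) * lx = lx + (rx + m * lx) by ring,
      show ry + (m + 1) * ly = ly + (ry + m * ly) by ring] at this

/-- The search for the steepest feasible direction from position `12` on. The vertical extent of
the feasible direction at least doubles in every round. -/
theorem halts_search (t : ℕ) : ∀ {lx ly rx ry : ℤ} {M : ℕ → ℤ},
    Stores n a b lx ly rx ry M → SlopeBracket n a b lx ly rx ry → 0 < ly →
    ¬ Feasible n a b (lx + rx) (ly + ry) → b ≤ 2 ^ t * ly →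
    ∃ u v k, 0 < u ∧ 0 < v ∧ IsCoprime u v ∧ 0 < k ∧ n ≤ (a + k * u) * (b - k * v) ∧
      (∀ i, n ≤ (a + i * u) * (b - i * v) → i ≤ k) ∧
      (∀ d e, 0 < d → Feasible n a b d e → u * e ≤ v * d) ∧
      HaltsFrom nextVertex ⟨12, M⟩ (52 * t) [1, a + k * u, b - k * v] := by
  induction t with
  | zero =>
    intro lx ly rx ry M _ hR _ _ hb
    have := hR.ly_lt
    omega
  | succ t ih =>
    intro lx ly rx ry M h hR hly hS hb
    -- A full round costs at most 31 + 21 = 52 instructions, and a terminating one at most 31 + 19.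
    obtain ⟨s, hs, M₁, ⟨r₁, s₁, hi⟩ | ⟨m, r₁, hm, s₁, hR₁, hS₁⟩⟩ := run_right h hR hly hS
    · obtain ⟨k, hk, hf, hmax, hh⟩ := halts_final s₁ hR.lx_pos hly hR.left
      refine ⟨lx, ly, k, hR.lx_pos, hly, ⟨ry, -rx, ?_⟩, hk, hf, hmax,
        fun d e hd => hR.steepest hi hd, (hh.of_run r₁).mono (by omega)⟩
      linear_combination hR.det
    · have hrx : 0 < rx + m * lx := by
        have := hR.rx_nonneg
        have := mul_pos hm hR.lx_pos
        omega
      obtain ⟨lx', ly', M₂, r₂, hly', hR₂, hS₂, s₂⟩ := run_left s₁ hR₁ hrx hS₁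
      have hdouble : 2 * ly ≤ ly' := by
        have := hR.ry_pos
        have : ly ≤ m * ly := le_mul_of_one_le_left hly.le hm
        omega
      obtain ⟨u, v, k, hu, hv, hc, hk, hf, hmax, hst, hh⟩ :=
        ih s₂ hR₂ (by omega) hS₂ (by
          rw [pow_succ, mul_assoc] at hb
          exact hb.trans (mul_le_mul_of_nonneg_left hdouble (by positivity)))
      exact ⟨u, v, k, hu, hv, hc, hk, hf, hmax, hst,
        ((hh.of_run r₂).of_run r₁).mono (by omega)⟩

/-! ### The initial phase -/

theorem halts_of_one (n a : ℤ) : HaltsFrom nextVertex (initial [n, a, 1]) 3 [0] := by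
  refine ⟨3, le_rfl, _, (run_const rfl).trans <| ((run_jumpEq rfl).trans
    (by rw [if_pos (by simp)])).trans <| (run_const rfl).trans rfl, rfl, ?_⟩
  intro i hi
  simp only [List.length_cons, List.length_nil] at hi
  interval_cases i
  simp

theorem run_setup (hb : b ≠ 1) :
    ∃ M, run nextVertex 8 (initial [n, a, b]) = some ⟨8, M⟩ ∧
      Stores n a b 1 0 (Int.fdiv (n - 1) (b - 1) - a) 1 M ∧ M 8 = n - 1 ∧ M 9 = b - 1 := by
  refine ⟨_, (run_const rfl).trans <| ((run_jumpEq rfl).trans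
    (by rw [if_neg (by simpa using hb)])).trans <| (run_const rfl).trans <|
    (run_const rfl).trans <| (run_sub rfl).trans <| (run_sub rfl).trans <|
    (run_div rfl (by simpa [sub_eq_zero] using hb)).trans <| (run_sub rfl).trans rfl, ?_, ?_, ?_⟩
  · constructor <;> simp
  · simp
  · simp

theorem run_setup_left (h : Stores n a b 1 0 rx 1 M) (hrx : 0 < rx) :
    run nextVertex 1 ⟨8, M⟩ = some ⟨43, M⟩ := by
  refine (run_jumpLt rfl).trans ?_
  rw [if_pos (by rwa [h.cell10, h.cell6])]
  rfl

theorem run_setup_right (h : Stores n a b 1 0 0 1 M) (h8 : M 8 = n - 1) (h9 : M 9 = b - 1)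
    (ha : a + 1 ≠ 0) :
    ∃ M', run nextVertex 4 ⟨8, M⟩ = some ⟨12, M'⟩ ∧
      Stores n a b 1 (b - 1 - Int.fdiv (n - 1) (a + 1)) 0 1 M' := by
  refine ⟨_, ((run_jumpLt rfl).trans
    (by rw [if_neg (by rw [h.cell10, h.cell6]; exact lt_irrefl _)])).trans <|
    (run_add rfl).trans <| (run_div rfl (by simpa [h.cell1, h.cell3] using ha)).trans <|
    (run_sub rfl).trans rfl, ?_⟩
  constructor <;> simp [h.1, h.2, h.3, h.4, h.5, h.7, h.8, h.9, h8, h9]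

/-- The initial part of the program, which leads to a bracket in which both directions are
adjusted. -/
theorem exists_bracket (hn : 0 < n) (ha : 0 < a) (hab : n ≤ a * b) (hlow : a * (b - 1) < n)
    (hb : 1 < b) :
    ∃ s ≤ 30, ∃ lx ly rx ry M, run nextVertex s (initial [n, a, b]) = some ⟨12, M⟩ ∧
      Stores n a b lx ly rx ry M ∧ SlopeBracket n a b lx ly rx ry ∧ 0 < ly ∧
      ¬ Feasible n a b (lx + rx) (ly + ry) := by
  have hI := SlopeBracket.initial hn ha hab hlow
  obtain ⟨M, r, s, h8, h9⟩ := run_setup (n := n) (a := a) hb.ne'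
  -- On the row b - 1, q is the last abscissa below the hyperbola. Division replaces the quadratic
  -- here, which degenerates for the axis directions (1, 0) and (0, 1).
  obtain ⟨q, hq⟩ : ∃ q, q = Int.fdiv (n - 1) (b - 1) := ⟨_, rfl⟩
  have hfd : ∀ {x : ℤ}, 0 < x → Int.fdiv (n - 1) x * x ≤ n - 1 ∧
      n - 1 < (Int.fdiv (n - 1) x + 1) * x := by
    intro x hx
    rw [Int.fdiv_eq_ediv_of_nonneg _ hx.le]
    exact ⟨Int.ediv_mul_le _ hx.ne', Int.lt_ediv_add_one_mul_self _ hx⟩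
  obtain ⟨hq1, hq2⟩ := hfd (by omega : 0 < b - 1)
  rw [← hq] at s hq1 hq2
  have haq : a ≤ q := by
    by_contra hc
    have := mul_le_mul_of_nonneg_right (by omega : q + 1 ≤ a) (by omega : 0 ≤ b - 1)
    omega
  rcases haq.eq_or_lt with rfl | haq
  -- R remains vertical, so L drops to the lowest admissible point of the column a + 1, again by
  -- division.
  · rw [sub_self] at s
    obtain ⟨M', r', s'⟩ := run_setup_right s h8 h9 (by omega)
    obtain ⟨hw1, hw2⟩ := hfd (by omega : 0 < a + 1)
    set w := Int.fdiv (n - 1) (a + 1)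
    have hw : w < b - 1 := by
      by_contra hc
      have := mul_le_mul_of_nonneg_right (by omega : b - 1 ≤ w) (by omega : 0 ≤ a + 1)
      linarith
    have hf : Feasible n a b (1 + (b - 1 - w) * 0) (0 + (b - 1 - w) * 1) := by
      unfold Feasible
      linarith
    have hB := hI.move_left (by omega) hf
    simp only [mul_zero, add_zero, mul_one, zero_add] at hB
    refine ⟨8 + 4, by norm_num, 1, b - 1 - w, 0, 1, M', (run_trans r).trans r', s', hB, by omega, ?_⟩
    unfold Feasible
    have : (a + (1 + 0)) * (b - (b - 1 - w + 1)) = w * (a + 1) := by ring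
    omega
  · have hB := hI.move_right (m := q - a) (by omega) (by
      intro i hi
      unfold Feasible
      have := mul_le_mul_of_nonneg_right (by omega : a + i ≤ q) (by omega : 0 ≤ b - 1)
      simp only [mul_zero, add_zero, mul_one, zero_add]
      omega)
    simp only [mul_zero, add_zero, mul_one, zero_add] at hB
    have hS : Feasible n a b (1 + (q - a)) (0 + 1) := by
      unfold Feasible
      have : (a + (1 + (q - a))) * (b - (0 + 1)) = (q + 1) * (b - 1) := by ring
      omega
    obtain ⟨lx', ly', M', r', hly, hB', hS', s'⟩ := run_left s hB (by omega) hS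
    exact ⟨8 + (1 + 21), by norm_num, lx', ly', q - a, 1, M',
      (run_trans r).trans ((run_trans (run_setup_left s (by omega))).trans r'), s', hB',
      by omega, hS'⟩

end RAM

/-! ### The logarithmic time bound and the conclusion -/

theorem isBigO_nat_log_add :
    (fun n : ℕ => ((30 + 52 * (Nat.log 2 n + 1) : ℕ) : ℝ)) =O[Filter.atTop]
      fun n : ℕ => Real.log (n : ℝ) := by
  -- 134 = 82 + 52: for n ≥ 2 the constant 82 = 30 + 52 is absorbed using log 2 ≤ log n.
  refine Asymptotics.IsBigO.of_bound (134 / Real.log 2) ?_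
  filter_upwards [Filter.eventually_ge_atTop 2] with n hn
  have h2 : 0 < Real.log 2 := Real.log_pos one_lt_two
  have hlog : Real.log 2 ≤ Real.log n := Real.log_le_log two_pos (by exact_mod_cast hn)
  have h1 : (Nat.log 2 n : ℝ) * Real.log 2 ≤ Real.log n := by
    rw [← Real.log_pow]
    exact Real.log_le_log (by positivity) (by exact_mod_cast Nat.pow_log_le_self 2 (by omega))
  rw [Real.norm_of_nonneg (by positivity), Real.norm_of_nonneg (h2.le.trans hlog),
    div_mul_eq_mul_div, le_div_iff₀ h2]
  push_cast
  linarith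

theorem theorem1p3 :
    ∃ (P : RAM.Program) (T : ℕ → ℕ),
      ((fun n : ℕ => (T n : ℝ)) =O[Filter.atTop] fun n : ℕ => Real.log (n : ℝ)) ∧
      ∀ n : ℕ, 0 < n → ∀ p : ℤ × ℤ, toPlane p ∈ hullVertices n →
        (∃ q : ℤ × ℤ, IsNextVertex n (toPlane p) (toPlane q) ∧
          ∃ t ≤ T n, RAM.HaltsWith P [(n : ℤ), p.1, p.2] t [1, q.1, q.2]) ∨
        (laterAbscissas n (toPlane p) = ∅ ∧
          ∃ t ≤ T n, RAM.HaltsWith P [(n : ℤ), p.1, p.2] t [0]) := by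
  refine ⟨RAM.nextVertex, fun n => 30 + 52 * (Nat.log 2 n + 1), isBigO_nat_log_add, ?_⟩
  rintro n hn ⟨a, b⟩ hp
  obtain ⟨ha, hb⟩ := pos_of_mem_hullVertices hn hp
  have hab := (bounds_of_mem_hullVertices hp).2.2
  have hlow := mul_pred_lt_of_mem_hullVertices hn hp
  rcases (show 1 ≤ b from hb).eq_or_lt with rfl | hb1
  · exact Or.inr ⟨laterAbscissas_eq_empty hn hp, (RAM.halts_of_one n a).mono (by dsimp only; omega)⟩
  · left
    obtain ⟨s, hs, lx, ly, rx, ry, M, r, hM, hB, hly, hS⟩ :=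
      RAM.exists_bracket (by exact_mod_cast hn) ha hab hlow hb1
    -- From a (b - 1) < n and a ≥ 1.
    have hbn : b ≤ n := by nlinarith
    have hpow : (n : ℤ) ≤ 2 ^ (Nat.log 2 n + 1) := by
      exact_mod_cast (Nat.lt_pow_succ_log_self one_lt_two n).le
    obtain ⟨u, v, k, hu, hv, hc, hk, hf, hmax, hst, hh⟩ :=
      RAM.halts_search (Nat.log 2 n + 1) hM hB hly hS
        ((hbn.trans hpow).trans (le_mul_of_one_le_right (by positivity) hly))
    exact ⟨(a + k * u, b - k * v), isNextVertex_of_steepest hn hp hu hv hc hk hf hmax hst,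
      (hh.of_run r).mono (by dsimp only; omega)⟩
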